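/- All logarithms are to base $2$. A weighted tree is a graph-theoretic tree $T$ with nonnegative edge weights; $d_T$ denotes its shortest path distance. A clan embedding of a metric space $(X,d_X)$ into $T$ is a pair $(f,\chi)$ in which $f$ assigns to each $x\in X$ a nonempty set $f(x)\subseteq V(T)$ (the copies of $x$), these sets being pairwise disjoint, with $d_T(x',y')\ge d_X(x,y)$ for all $x,y\in X$, $x'\in f(x)$, $y'\in f(y)$, and in which $\chi:X\to V(T)$ satisfies $\chi(x)\in f(x)$ for every $x$. It has multiplicative distortion $t$ if $\min_{y'\in f(y)}d_T(y',\chi(x))\le t\cdot d_X(x,y)$ for all $x,y\in X$. Theorem (lower bound for clan embedding into a tree). 1. There is a universal constant $c>0$ such that for every $\epsilon\in(0,1)$ and every sufficiently large $n$ (depending on $\epsilon$) there is an $n$-point metric space $(X,d_X)$ such that every clan embedding $(f,\chi)$ of $X$ into a weighted tree with multiplicative distortion at most $c\cdot\frac{\log n}{\epsilon}$ satisfies $\sum_{x\in X}|f(x)|\ge(1+\epsilon)n$. 2. There are universal constants $c,c'>0$ such that for all integers $k\ge1$ and $n\ge 0$ there is an $n$-point metric space $(X,d_X)$ such that every clan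 embedding $(f,\chi)$ of $X$ into a weighted tree with multiplicative distortion at most $c\cdot k$ satisfies $\sum_{x\in X}|f(x)|\ge c'\cdot n^{1+\frac1k}$. -/

import Mathlib

open scoped NNReal ENNReal

universe u v

/-- The total weight of the edges (with multiplicity) traversed by a walk. -/
def walkWeight {V : Type u} {G : SimpleGraph V} (w : Sym2 V → ℝ≥0) {a b : V}
    (p : G.Walk a b) : ℝ≥0 :=
  (p.edges.map w).sum

/-- The shortest path distance of the graph `G` with nonnegative edge weights `w`: the infimum of
the weights of the walks between two vertices. Only the values of `w` on edges of `G` matter. It is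
used below for trees only, so that the infimum is over a nonempty set, and it is the weight of the
unique path between the two vertices. -/
noncomputable def weightedDist {V : Type u} (G : SimpleGraph V) (w : Sym2 V → ℝ≥0)
    (a b : V) : ℝ :=
  ((⨅ p : G.Walk a b, walkWeight w p : ℝ≥0) : ℝ)

/-- `(f, χ)` is a clan embedding of the metric space `X` into `(Y, dY)`: the clans `f x` are
nonempty and pairwise disjoint, copies are at least as far apart as the original points, and the
chief `χ x` is one of the copies of `x`. -/
structure IsClanEmbedding {X : Type v} [MetricSpace X] {Y : Type u} (dY : Y → Y → ℝ)
    (f : X → Set Y) (χ : X → Y) : Prop where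
  nonempty : ∀ x, (f x).Nonempty
  disjoint : ∀ x y, x ≠ y → Disjoint (f x) (f y)
  dominating : ∀ x y, ∀ x' ∈ f x, ∀ y' ∈ f y, dist x y ≤ dY x' y'
  chief_mem : ∀ x, χ x ∈ f x

/-- `(f, χ)` has multiplicative distortion (at most) `t`: for all `x` and `y`, some copy of `y` is
within distance `t * dist x y` of the chief of `x`. -/
def HasClanDistortion {X : Type v} [MetricSpace X] {Y : Type u} (dY : Y → Y → ℝ)
    (f : X → Set Y) (χ : X → Y) (t : ℝ) : Prop :=
  ∀ x y, ∃ y' ∈ f y, dY y' (χ x) ≤ t * dist x y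

/-- The total number of copies, which is `∞` if some clan is infinite. -/
noncomputable def totalCopies {X : Type v} [Fintype X] {Y : Type u} (f : X → Set Y) : ℝ≥0∞ :=
  ∑ x, ((f x).encard : ℝ≥0∞)

/-! The metric is that of a connected graph `G` whose cycles are longer than `16 * t`; the claim is
that a clan embedding of distortion `t` then needs at least as many copies as `G` has edges
(`card_edgeSet_le_totalCopies`). Short walks between two given points of `G` use each edge with the
same parity, so sending a close pair to this parity vector is a cocycle `P` with values in the space
`Sym2 X → ZMod 2`. Label each tree vertex by a point with a copy near it. A tree has no cycles, so
the pulled-back `P` integrates to a vertex function `F`. On the short walk from the chief of `x` to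
a nearby copy of `y`, all labels stay close to `x` and the sum telescopes to `P x y`. Hence every
edge indicator is a difference of values of `F` at copies, and comparing dimensions bounds the
number of copies below.

It remains to find graphs of large girth with many edges. A tree inside a path is extended greedily
under a degree bound; by maximality, the vertices still below the bound lie in one ball, so ball
growth controls the loss. Adding edges at all vertices gives part 2. For part 1 with small `ε`, a
matching is added between vertices about `1 / (8 * ε)` apart, which stretches the girth by that
factor. -/

/-! ### Integrating edge functions on a tree -/

section Potential

variable {V : Type u} {T : SimpleGraph V}

/-- An antisymmetric function on the edges of a tree is the coboundary of a vertex function. -/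
lemma SimpleGraph.IsTree.exists_potential (hT : T.IsTree) {A : Type*} [AddCommGroup A]
    (ψ : V → V → A) (hψ : ∀ v w, ψ v w + ψ w v = 0) :
    ∃ F : V → A, ∀ v w, T.Adj v w → F w = F v + ψ v w := by
  obtain ⟨r⟩ := hT.connected.nonempty
  choose p hp _ using fun v => hT.existsUnique_path r v
  -- The potential is the sum of `ψ` along the path from the root; root paths of adjacent vertices
  -- differ by exactly their common edge.
  have key : ∀ v w (h : T.Adj v w), v ∈ (p w).support →
      ((p w).darts.map fun d => ψ d.fst d.snd).sum
        = ((p v).darts.map fun d => ψ d.fst d.snd).sum + ψ v w := by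
    intro v w h hv
    rw [hT.isAcyclic.path_concat (hp v) (hp w) h hv]
    simp [SimpleGraph.Walk.darts_concat]
  refine ⟨fun v => ((p v).darts.map fun d => ψ d.fst d.snd).sum, fun v w h => ?_⟩
  by_cases hv : v ∈ (p w).support
  · exact key v w h hv
  · have hw := hT.isAcyclic.mem_support_of_ne_mem_support_of_adj_of_isPath (hp v) (hp w) h hv
    have := key w v h.symm hw
    dsimp only
    rw [this, add_assoc, add_comm (ψ w v), hψ, add_zero]

end Potential

/-! ### Shortest path distance -/

section WeightedDist

variable {V : Type u} {G : SimpleGraph V} (w : Sym2 V → ℝ≥0)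

lemma weightedDist_le_walkWeight {a b : V} (p : G.Walk a b) :
    weightedDist G w a b ≤ walkWeight w p :=
  NNReal.coe_le_coe.2 (ciInf_le (OrderBot.bddBelow _) p)

@[simp] lemma weightedDist_self (a : V) : weightedDist G w a a = 0 :=
  le_antisymm (by simpa [walkWeight] using weightedDist_le_walkWeight w (.nil : G.Walk a a))
    (NNReal.coe_nonneg _)

lemma exists_walkWeight_lt (hG : G.Connected) {a b : V} {s : ℝ} (h : weightedDist G w a b < s) :
    ∃ p : G.Walk a b, walkWeight w p < s := by
  have : Nonempty (G.Walk a b) := hG.preconnected a b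
  by_contra! H
  refine h.not_ge ?_
  have hs : s.toNNReal ≤ ⨅ p : G.Walk a b, walkWeight w p :=
    le_ciInf fun p => Real.toNNReal_le_iff_le_coe.2 (H p)
  exact Real.toNNReal_le_iff_le_coe.1 hs

lemma walkWeight_reverse {a b : V} (p : G.Walk a b) : walkWeight w p.reverse = walkWeight w p := by
  simp [walkWeight]

lemma walkWeight_append {a b c : V} (p : G.Walk a b) (q : G.Walk b c) :
    walkWeight w (p.append q) = walkWeight w p + walkWeight w q := by
  simp [walkWeight]

lemma walkWeight_concat {a b c : V} (p : G.Walk a b) (h : G.Adj b c) :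
    walkWeight w (p.concat h) = walkWeight w p + w s(b, c) := by
  simp [walkWeight, SimpleGraph.Walk.edges_concat]

lemma weightedDist_comm (a b : V) : weightedDist G w a b = weightedDist G w b a := by
  have key : ∀ a b : V, weightedDist G w a b ≤ weightedDist G w b a := fun a b => by
    rcases isEmpty_or_nonempty (G.Walk b a) with h | h
    · have : IsEmpty (G.Walk a b) := ⟨fun p => h.elim p.reverse⟩
      simp only [weightedDist, iInf_of_isEmpty, le_refl]
    · refine NNReal.coe_le_coe.2 (le_ciInf fun p => ?_)
      rw [← walkWeight_reverse]
      exact ciInf_le (OrderBot.bddBelow _) p.reverse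
  exact le_antisymm (key a b) (key b a)

lemma weightedDist_triangle (hG : G.Connected) (a b c : V) :
    weightedDist G w a c ≤ weightedDist G w a b + weightedDist G w b c := by
  refine le_of_forall_pos_le_add fun η hη => ?_
  obtain ⟨p, hp⟩ := exists_walkWeight_lt w hG
    (show weightedDist G w a b < weightedDist G w a b + η / 2 by linarith)
  obtain ⟨q, hq⟩ := exists_walkWeight_lt w hG
    (show weightedDist G w b c < weightedDist G w b c + η / 2 by linarith)
  have := weightedDist_le_walkWeight w (p.append q)
  rw [walkWeight_append, NNReal.coe_add] at this
  linarith

end WeightedDist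

/-! ### Pulling a cocycle back to the tree -/

section Cocycle

variable {X : Type v} [MetricSpace X] {V : Type u} {T : SimpleGraph V} {w : Sym2 V → ℝ≥0}
  {f : X → Set V} {χ : X → V} {t : ℝ}

/-- A cocycle on the small triangles of `X` is pulled back, along a clan embedding of small
distortion, to a coboundary on the tree. -/
lemma IsClanEmbedding.exists_potential (hT : T.IsTree)
    (hf : IsClanEmbedding (weightedDist T w) f χ)
    (ht : HasClanDistortion (weightedDist T w) f χ t) (ht0 : 0 < t)
    {A : Type*} [AddCommGroup A] (P : X → X → A) (hP : ∀ x y, P x y + P y x = 0)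
    (hcoc : ∀ x y z, dist x y ≤ 4 * t → dist x z ≤ 4 * t → P x y + P y z = P x z) :
    ∃ F : V → A, ∀ x y, dist x y ≤ 1 → ∃ c ∈ f x, ∃ c' ∈ f y, F c' - F c = P x y := by
  classical
  rcases isEmpty_or_nonempty X with hX | ⟨⟨x₀⟩⟩
  · exact ⟨fun _ => 0, fun x => hX.elim x⟩
  -- `a v` is a point of `X` with a copy near `v`, when there is one
  have ha : ∀ v, ∃ x, (∀ y, v ∈ f y → x = y) ∧
      ((∃ y, ∃ c ∈ f y, weightedDist T w c v ≤ 2 * t) →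
        ∃ c ∈ f x, weightedDist T w c v ≤ 2 * t) := by
    intro v
    by_cases h : ∃ y, v ∈ f y
    · obtain ⟨x, hx⟩ := h
      refine ⟨x, fun y hy => ?_, fun _ => ⟨v, hx, by simp [ht0.le]⟩⟩
      by_contra hne
      exact Set.disjoint_left.1 (hf.disjoint x y hne) hx hy
    · by_cases h' : ∃ y, ∃ c ∈ f y, weightedDist T w c v ≤ 2 * t
      · obtain ⟨x, hx⟩ := h'
        exact ⟨x, fun y hy => (h ⟨y, hy⟩).elim, fun _ => hx⟩
      -- An arbitrary label is harmless here: the walks considered below never reach a vertex far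
      -- from all copies.
      · exact ⟨x₀, fun y hy => (h ⟨y, hy⟩).elim, fun h'' => (h' h'').elim⟩
  choose a ha₁ ha₂ using ha
  obtain ⟨F, hF⟩ := hT.exists_potential (fun v v' => P (a v) (a v')) fun v v' => hP _ _
  refine ⟨F, fun x y hxy => ?_⟩
  obtain ⟨y', hy', hd⟩ := ht x y
  -- The distance is at most `t`; the slack up to `2 * t` gives an actual walk without attaining the
  -- infimum.
  obtain ⟨p, hp⟩ := exists_walkWeight_lt w hT.connected (a := χ x) (b := y') (s := 2 * t) <| by
    rw [weightedDist_comm]; nlinarith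
  refine ⟨χ x, hf.chief_mem x, y', hy', ?_⟩
  -- At most `2 * t` to `v` and `2 * t` on to a copy of its label: hence the radius `4 * t` in
  -- `hcoc`.
  have near : ∀ v (q : T.Walk (χ x) v), walkWeight w q ≤ 2 * t → dist x (a v) ≤ 4 * t := by
    intro v q hq
    have h1 := (weightedDist_le_walkWeight w q).trans hq
    obtain ⟨c, hc, hcv⟩ := ha₂ v ⟨x, χ x, hf.chief_mem x, h1⟩
    have h2 := hf.dominating x (a v) (χ x) (hf.chief_mem x) c hc
    have h3 := weightedDist_triangle w hT.connected (χ x) v c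
    rw [weightedDist_comm w v c] at h3
    linarith
  have hPxx : P x x = 0 := by
    have := hcoc x x x (by simp [ht0.le]) (by simp [ht0.le])
    simpa using this
  -- The prefix `q₀` records the way already made from the chief, so that `near` applies at every
  -- vertex of `q`.
  have walk : ∀ u v (q : T.Walk u v) (q₀ : T.Walk (χ x) u), walkWeight w (q₀.append q) ≤ 2 * t →
      F v - F u = P x (a v) - P x (a u) := by
    intro u v q
    induction q with
    | nil => simp
    | @cons u u' v h q ih =>
      intro q₀ hq
      rw [← SimpleGraph.Walk.concat_append] at hq
      have h1 := ih (q₀.concat h) hq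
      rw [walkWeight_append, walkWeight_concat, NNReal.coe_add, NNReal.coe_add] at hq
      have hq1 : (walkWeight w q₀ : ℝ) ≤ 2 * t := by
        linarith [(walkWeight w q).coe_nonneg, (w s(u, u')).coe_nonneg]
      have hq2 : (walkWeight w (q₀.concat h) : ℝ) ≤ 2 * t := by
        rw [walkWeight_concat, NNReal.coe_add]
        linarith [(walkWeight w q).coe_nonneg]
      have h2 := hcoc x (a u) (a u') (near _ _ hq1) (near _ _ hq2)
      rw [← sub_add_sub_cancel (F v) (F u') (F u), h1, hF u u' h, ← h2]
      abel
  rw [walk _ _ p .nil (by simpa using hp.le), ha₁ y' y hy', ha₁ (χ x) x (hf.chief_mem x), hPxx,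
    sub_zero]

end Cocycle

/-! ### Parity of closed walks and short cycles -/

section Girth

variable {V : Type v} {G : SimpleGraph V}

/-- The edge `e` alone crosses the cut defined by `S`, so each traversal of it switches sides. -/
lemma SimpleGraph.Walk.even_count_edges_iff [DecidableEq V] (S : Set V) (e : Sym2 V)
    (h : ∀ a b, G.Adj a b → (s(a, b) = e ↔ ¬(a ∈ S ↔ b ∈ S))) {a b : V} (p : G.Walk a b) :
    Even (p.edges.count e) ↔ (a ∈ S ↔ b ∈ S) := by
  induction p with
  | nil => simp
  | @cons a b c hab p ih =>
    have := h a b hab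
    rw [SimpleGraph.Walk.edges_cons, List.count_cons]
    by_cases he : s(a, b) = e
    · simp only [he, beq_self_eq_true, if_true, Nat.even_add_one, ih]
      tauto
    · have hbe : (s(a, b) == e) = false := by simpa using he
      simp only [hbe, Bool.false_eq_true, if_false, add_zero, ih]
      tauto

lemma SimpleGraph.Walk.IsTrail.length_le_of_edges_subset {H : SimpleGraph V} {a b a' b' : V}
    {q : H.Walk a' b'} (hq : q.IsTrail) (p : G.Walk a b)
    (h : ∀ e ∈ q.edges, e ∈ p.edges) : q.length ≤ p.length := by
  rw [← q.length_edges, ← p.length_edges]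
  exact (List.subperm_of_subset hq.edges_nodup h).length_le

/-- Below the girth, closed walks traverse every edge an even number of times. -/
lemma SimpleGraph.Walk.even_count_edges_of_lt_girth [DecidableEq V] {g : ℕ}
    (hg : ∀ v (c : G.Walk v v), c.IsCycle → g < c.length) {v : V} (c : G.Walk v v)
    (hc : c.length ≤ g) (e : Sym2 V) : Even (c.edges.count e) := by
  by_cases he : e ∈ c.edges
  swap
  · simp [List.count_eq_zero_of_not_mem he]
  let H : SimpleGraph V := SimpleGraph.fromEdgeSet {e | e ∈ c.edges}
  have hHc : ∀ e, e ∈ H.edgeSet → e ∈ c.edges := fun e he => by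
    simpa [H] using (SimpleGraph.edgeSet_fromEdgeSet _ ▸ he).1
  have hcH : ∀ e ∈ c.edges, e ∈ H.edgeSet := fun e he => by
    rw [SimpleGraph.edgeSet_fromEdgeSet]
    exact ⟨he, G.not_isDiag_of_mem_edgeSet (c.edges_subset_edgeSet he)⟩
  induction e with | h x y =>
  -- A cycle of `H` uses only edges of `c`, hence is too short for `G`. So every edge of `H` is a
  -- bridge, and deleting it yields the cut.
  have hbr : ¬ (H.deleteEdges {s(x, y)}).Reachable x y := by
    intro hr
    obtain ⟨u, q, hq, -⟩ :=
      SimpleGraph.adj_and_reachable_delete_edges_iff_exists_cycle.1 ⟨hcH _ he, hr⟩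
    have hqc : ∀ e ∈ q.edges, e ∈ c.edges := fun e he => hHc e (q.edges_subset_edgeSet he)
    have h1 := hg u (q.transfer G fun e he => c.edges_subset_edgeSet (hqc e he)) (hq.transfer _)
    rw [SimpleGraph.Walk.length_transfer] at h1
    have h2 := hq.isTrail.length_le_of_edges_subset c hqc
    omega
  have := SimpleGraph.Walk.even_count_edges_iff (G := H)
    {z | (H.deleteEdges {s(x, y)}).Reachable x z} s(x, y) ?_ (c.transfer H hcH)
  · simpa using this
  · intro a b hab
    by_cases hs : s(a, b) = s(x, y)
    · simp only [hs, true_iff, Set.mem_ofPred_eq]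
      rcases Sym2.eq_iff.1 hs with ⟨rfl, rfl⟩ | ⟨rfl, rfl⟩
      · exact fun h => hbr (h.1 .rfl)
      · exact fun h => hbr (h.2 .rfl)
    · have hab' : (H.deleteEdges {s(x, y)}).Adj a b := by
        simpa [SimpleGraph.deleteEdges_adj] using ⟨hab, by simpa using hs⟩
      simp only [hs, false_iff, not_not, Set.mem_ofPred_eq]
      exact ⟨fun h => h.trans hab'.reachable, fun h => h.trans hab'.symm.reachable⟩

/-- If joining `x` and `y` creates a short cycle, then `x` and `y` are close to each other. -/
lemma SimpleGraph.exists_walk_of_isCycle_sup_edge {x y : V} {g : ℕ}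
    (hg : ∀ v (c : G.Walk v v), c.IsCycle → g < c.length) {v : V}
    (c : (G ⊔ SimpleGraph.edge x y).Walk v v) (hc : c.IsCycle) (hcg : c.length ≤ g) :
    ∃ p : G.Walk x y, p.length ≤ g := by
  classical
  have hG : ∀ e ∈ c.edges, e ≠ s(x, y) → e ∈ G.edgeSet := fun e he hne => by
    have := c.edges_subset_edgeSet he
    rw [SimpleGraph.edgeSet_sup] at this
    rcases this with h | h
    · exact h
    · exact (hne (by simpa using (SimpleGraph.edgeSet_fromEdgeSet _ ▸ h).1)).elim
  let H : SimpleGraph V := SimpleGraph.fromEdgeSet {e | e ∈ c.edges}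
  have hHc : ∀ e, e ∈ H.edgeSet → e ∈ c.edges := fun e he => by
    simpa [H] using (SimpleGraph.edgeSet_fromEdgeSet _ ▸ he).1
  have hcH : ∀ e ∈ c.edges, e ∈ H.edgeSet := fun e he => by
    rw [SimpleGraph.edgeSet_fromEdgeSet]
    exact ⟨he, SimpleGraph.not_isDiag_of_mem_edgeSet _ (c.edges_subset_edgeSet he)⟩
  -- If the cycle uses the new edge, the rest of it joins `x` to `y` in `G`; otherwise it is already
  -- a short cycle of `G`.
  by_cases hxy : s(x, y) ∈ c.edges
  · obtain ⟨-, hr⟩ := SimpleGraph.adj_and_reachable_delete_edges_iff_exists_cycle.2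
      ⟨v, c.transfer H hcH, hc.transfer _, by simpa using hxy⟩
    obtain ⟨p, hp⟩ := hr.exists_isPath
    have hpc : ∀ e ∈ p.edges, e ∈ c.edges ∧ e ≠ s(x, y) := fun e he => by
      have := p.edges_subset_edgeSet he
      rw [SimpleGraph.edgeSet_deleteEdges] at this
      exact ⟨hHc _ this.1, this.2⟩
    refine ⟨p.transfer G fun e he => hG e (hpc e he).1 (hpc e he).2, ?_⟩
    rw [SimpleGraph.Walk.length_transfer]
    exact (hp.isTrail.length_le_of_edges_subset c fun e he => (hpc e he).1).trans hcg
  · have hG' : ∀ e ∈ c.edges, e ∈ G.edgeSet := fun e he => hG e he (by rintro rfl; exact hxy he)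
    have := hg v (c.transfer G hG') (hc.transfer _)
    rw [SimpleGraph.Walk.length_transfer] at this
    omega

end Girth

/-- The shortest path metric of a connected graph. -/
noncomputable abbrev SimpleGraph.Connected.metricSpace {X : Type v} {G : SimpleGraph X}
    (hG : G.Connected) : MetricSpace X where
  dist x y := G.dist x y
  dist_self x := by simp
  dist_comm x y := by simp [SimpleGraph.dist_comm]
  dist_triangle x y z := by exact_mod_cast hG.dist_triangle
  eq_of_dist_eq_zero {x y} h := hG.dist_eq_zero_iff.1 (by exact_mod_cast h)

/-! ### The edge cocycle and the dimension count -/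

section Cocycle

variable {X : Type v} {G : SimpleGraph X}

/-- Sending a pair of close points to the edges of a short walk between them is a cocycle. -/
lemma SimpleGraph.exists_edge_cocycle [DecidableEq X] {m : ℕ}
    (hg : ∀ v (c : G.Walk v v), c.IsCycle → 2 * m < c.length) :
    ∃ P : X → X → Sym2 X → ZMod 2, (∀ x y, P x y + P y x = 0) ∧
      ∀ x y (p : G.Walk x y), p.length ≤ m → P x y = fun e => (p.edges.count e : ZMod 2) := by
  classical
  let P : X → X → Sym2 X → ZMod 2 := fun x y =>
    if h : ∃ p : G.Walk x y, p.length ≤ m then fun e => (h.choose.edges.count e : ZMod 2) else 0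
  have hP : ∀ x y (p : G.Walk x y), p.length ≤ m →
      P x y = fun e => (p.edges.count e : ZMod 2) := by
    intro x y p hp
    have h : ∃ p : G.Walk x y, p.length ≤ m := ⟨p, hp⟩
    funext e
    simp only [P, dif_pos h]
    -- Two short walks close up to length at most `2 * m`, so the parities do not depend on the walk
    -- chosen.
    have := (p.append h.choose.reverse).even_count_edges_of_lt_girth hg
      (by rw [SimpleGraph.Walk.length_append, SimpleGraph.Walk.length_reverse]
          have := h.choose_spec; omega) e
    rw [SimpleGraph.Walk.edges_append, List.count_append, SimpleGraph.Walk.edges_reverse,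
      List.count_reverse, ← ZMod.natCast_eq_zero_iff_even, Nat.cast_add] at this
    rw [eq_comm, ← sub_eq_zero, CharTwo.sub_eq_add, this]
  refine ⟨P, fun x y => ?_, hP⟩
  by_cases h : ∃ p : G.Walk x y, p.length ≤ m
  · obtain ⟨p, hp⟩ := h
    rw [hP x y p hp, hP y x p.reverse (by simpa using hp)]
    funext e
    simp [CharTwo.add_self_eq_zero]
  · have h' : ¬ ∃ p : G.Walk y x, p.length ≤ m := fun ⟨p, hp⟩ => h ⟨p.reverse, by simpa using hp⟩
    simp only [P, dif_neg h, dif_neg h', add_zero]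

/-- A clan embedding of a graph into a tree, of distortion small compared to the girth, has at
least as many copies as the graph has edges. -/
theorem card_edgeSet_le_totalCopies [Fintype X] (hG : G.Connected) {t : ℝ}
    (hg : ∀ v (c : G.Walk v v), c.IsCycle → 16 * t < c.length)
    {V : Type u} {T : SimpleGraph V} (w : Sym2 V → ℝ≥0) (hT : T.IsTree) (f : X → Set V) (χ : X → V)
    (hf : letI := hG.metricSpace; IsClanEmbedding (weightedDist T w) f χ)
    (ht : letI := hG.metricSpace; HasClanDistortion (weightedDist T w) f χ t) :
    (Nat.card G.edgeSet : ℝ≥0∞) ≤ totalCopies f := by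
  classical
  let := hG.metricSpace
  have hdist : ∀ x y : X, dist x y = G.dist x y := fun _ _ => rfl
  by_cases hinf : ∃ x, (f x).Infinite
  · obtain ⟨x, hx⟩ := hinf
    have : totalCopies f = ⊤ :=
      ENNReal.sum_eq_top.2 ⟨x, Finset.mem_univ x, by simp [hx.encard_eq]⟩
    simp [this]
  push Not at hinf
  rcases isEmpty_or_nonempty G.edgeSet with hE | ⟨⟨e₀, he₀⟩⟩
  · simp
  have ht0 : 0 < t := by
    induction e₀ with | h x y =>
    have hxy : dist x y = 1 := by
      rw [hdist, SimpleGraph.dist_eq_one_iff_adj.2 he₀, Nat.cast_one]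
    obtain ⟨y', hy', h⟩ := ht x y
    have := hf.dominating x y _ (hf.chief_mem x) y' hy'
    rw [weightedDist_comm, hxy] at this
    rw [hxy, mul_one] at h
    linarith
  -- Two points within `4 * t` of `x` are joined by a walk of length at most `8 * t`; closing up two
  -- such walks accounts for `16 * t`.
  obtain ⟨P, hPsymm, hP⟩ := SimpleGraph.exists_edge_cocycle (G := G) (m := ⌊8 * t⌋₊)
    fun v c hc => by
      have h1 := hg v c hc
      have h2 := Nat.floor_le (show 0 ≤ 8 * t by positivity)
      exact_mod_cast (show ((2 * ⌊8 * t⌋₊ : ℕ) : ℝ) < c.length by push_cast; linarith)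
  obtain ⟨F, hF⟩ := hf.exists_potential hT ht ht0 P hPsymm <| by
    intro x y z hxy hxz
    obtain ⟨p, hp⟩ := hG.exists_walk_length_eq_dist x y
    obtain ⟨q, hq⟩ := hG.exists_walk_length_eq_dist x z
    rw [hdist, ← hp] at hxy
    rw [hdist, ← hq] at hxz
    rw [hP x y p (Nat.le_floor (by linarith)), hP x z q (Nat.le_floor (by linarith)),
      hP y z (p.reverse.append q) (Nat.le_floor (by
        push_cast [SimpleGraph.Walk.length_append, SimpleGraph.Walk.length_reverse]
        linarith))]
    funext e
    simp only [Pi.add_apply, SimpleGraph.Walk.edges_append, List.count_append,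
      SimpleGraph.Walk.edges_reverse, List.count_reverse, Nat.cast_add]
    rw [← add_assoc, CharTwo.add_self_eq_zero, zero_add]
  let C : Finset V := Finset.univ.biUnion fun x => (hinf x).toFinset
  have hC : (C.card : ℝ≥0∞) ≤ totalCopies f := by
    have h1 : C.card ≤ ∑ x, (hinf x).toFinset.card := Finset.card_biUnion_le
    have h2 : totalCopies f = ((∑ x, (hinf x).toFinset.card : ℕ) : ℝ≥0∞) := by
      rw [totalCopies, Nat.cast_sum]
      refine Finset.sum_congr rfl fun x _ => ?_
      rw [(hinf x).encard_eq_coe_toFinset_card]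
      simp
    rw [h2]
    exact_mod_cast h1
  refine le_trans ?_ hC
  have hmem : ∀ x, ∀ c ∈ f x, F c ∈ Submodule.span (ZMod 2) (C.image F : Set (Sym2 X → ZMod 2)) :=
    fun x c hc => Submodule.subset_span <| by
      simp only [Finset.coe_image]
      exact ⟨c, by simpa [C] using ⟨x, hc⟩, rfl⟩
  have hli : LinearIndependent (ZMod 2)
      (fun e : G.edgeSet => (Pi.single (e : Sym2 X) 1 : Sym2 X → ZMod 2)) := by
    have := (Pi.basisFun (ZMod 2) (Sym2 X)).linearIndependent.comp _
      (Subtype.val_injective (p := (· ∈ G.edgeSet)))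
    simpa [Function.comp_def] using this
  -- The edge indicators are independent, yet lie in a span of at most `C.card` vectors.
  have hle : Submodule.span (ZMod 2) (Set.range
      (fun e : G.edgeSet => (Pi.single (e : Sym2 X) 1 : Sym2 X → ZMod 2)))
      ≤ Submodule.span (ZMod 2) (C.image F : Set (Sym2 X → ZMod 2)) := by
    rw [Submodule.span_le]
    rintro _ ⟨⟨e, he⟩, rfl⟩
    induction e with | h x y =>
    obtain ⟨c, hc, c', hc', h⟩ := hF x y (by
      rw [hdist, SimpleGraph.dist_eq_one_iff_adj.2 he, Nat.cast_one])
    have ht1 : 1 ≤ ⌊8 * t⌋₊ := by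
      obtain ⟨z', hz', hz⟩ := ht x y
      have := hf.dominating x y _ (hf.chief_mem x) z' hz'
      rw [weightedDist_comm] at this
      have hxy : dist x y = 1 := by
        rw [hdist, SimpleGraph.dist_eq_one_iff_adj.2 he, Nat.cast_one]
      refine Nat.le_floor ?_
      rw [hxy] at this hz
      push_cast
      linarith
    have hxy : G.Adj x y := he
    rw [hP x y (SimpleGraph.Walk.cons hxy .nil) (by
      rwa [SimpleGraph.Walk.length_cons, SimpleGraph.Walk.length_nil])] at h
    have hs : (Pi.single s(x, y) 1 : Sym2 X → ZMod 2) = F c' - F c := by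
      rw [h]
      funext e
      by_cases hexy : e = s(x, y)
      · simp [hexy]
      · simp [hexy, Ne.symm hexy]
    show (Pi.single s(x, y) 1 : Sym2 X → ZMod 2) ∈ _
    rw [hs]
    exact sub_mem (hmem y c' hc') (hmem x c hc)
  have h1 := Submodule.finrank_mono hle
  rw [finrank_span_eq_card hli] at h1
  have h2 := (finrank_span_finset_le_card (R := ZMod 2) (C.image F)).trans Finset.card_image_le
  rw [Nat.card_eq_fintype_card]
  exact_mod_cast h1.trans h2

end Cocycle

/-! ### Greedy extension without short cycles -/

section Greedy

variable {V : Type v}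

lemma SimpleGraph.neighborSet_sup_edge_sdiff_subset (G B : SimpleGraph V) (x y z : V) :
    ((G ⊔ SimpleGraph.edge x y) \ B).neighborSet z ⊆
      (G \ B).neighborSet z ∪ ({v | z = x ∧ v = y} ∪ {v | z = y ∧ v = x}) := by
  intro v hv
  simp only [SimpleGraph.mem_neighborSet, SimpleGraph.sdiff_adj, SimpleGraph.sup_adj,
    SimpleGraph.edge_adj] at hv
  simp only [Set.mem_union, SimpleGraph.mem_neighborSet, SimpleGraph.sdiff_adj, Set.mem_ofPred_eq]
  tauto

/-- Greedily adding edges between the vertices of `S`, at most `d` at each of them and without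
creating a cycle of length at most `g`, ends with few vertices of small degree in `S`. -/
lemma SimpleGraph.exists_extension_of_lt_girth [Finite V] (B : SimpleGraph V) (S : Set V)
    {d g M : ℕ} (hg1 : 1 ≤ g) (hB : ∀ v (c : B.Walk v v), c.IsCycle → g < c.length)
    (hball : ∀ G : SimpleGraph V, B ≤ G → (∀ x y, (G \ B).Adj x y → x ∈ S) →
      (∀ x, ((G \ B).neighborSet x).ncard ≤ d) →
      ∀ x ∈ S, {y ∈ S | ∃ p : G.Walk x y, p.length ≤ g}.ncard ≤ M) :
    ∃ G : SimpleGraph V, B ≤ G ∧ (∀ v (c : G.Walk v v), c.IsCycle → g < c.length) ∧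
      {x ∈ S | ((G \ B).neighborSet x).ncard < d}.ncard ≤ M := by
  let Q : SimpleGraph V → Prop := fun G => B ≤ G ∧ (∀ x y, (G \ B).Adj x y → x ∈ S) ∧
    (∀ x, ((G \ B).neighborSet x).ncard ≤ d) ∧ ∀ v (c : G.Walk v v), c.IsCycle → g < c.length
  have hQB : Q B := ⟨le_rfl, by simp, by simp [SimpleGraph.neighborSet], hB⟩
  obtain ⟨G, -, hG⟩ := (Set.toFinite {G | Q G}).exists_le_maximal hQB
  obtain ⟨hBG, hS, hd, hgG⟩ := hG.prop
  refine ⟨G, hBG, hgG, ?_⟩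
  rcases Set.eq_empty_or_nonempty {x ∈ S | ((G \ B).neighborSet x).ncard < d} with h | ⟨x, hx⟩
  · rw [h, Set.ncard_empty]
    exact Nat.zero_le _
  -- Fix one deficient `x`. A deficient `y` with no walk of length at most `g` from `x` could be
  -- joined to `x`, against maximality.
  refine le_trans (Set.ncard_le_ncard ?_ (Set.toFinite _)) (hball G hBG hS hd x hx.1)
  intro y hy
  refine ⟨hy.1, ?_⟩
  by_cases hxy : x = y
  · subst hxy
    exact ⟨.nil, by simp⟩
  by_cases hadj : G.Adj x y
  · exact ⟨.cons hadj .nil, by simpa using hg1⟩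
  have hlt := SimpleGraph.lt_sup_edge G x y hxy hadj
  by_contra hno
  refine hlt.not_ge (hG.le_of_ge (y := G ⊔ SimpleGraph.edge x y) ⟨hBG.trans le_sup_left, ?_, ?_, ?_⟩
    le_sup_left)
  · intro a b hab
    have := SimpleGraph.neighborSet_sup_edge_sdiff_subset G B x y a hab
    rcases this with h | ⟨rfl, -⟩ | ⟨rfl, -⟩
    · exact hS a b h
    · exact hx.1
    · exact hy.1
  · intro z
    have hsub := SimpleGraph.neighborSet_sup_edge_sdiff_subset G B x y z
    by_cases hzx : z = x
    · subst hzx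
      have : ((G ⊔ SimpleGraph.edge z y) \ B).neighborSet z ⊆
          insert y ((G \ B).neighborSet z) := by
        intro v hv
        rcases hsub hv with h | ⟨-, rfl⟩ | ⟨h, -⟩
        · exact Set.mem_insert_of_mem _ h
        · exact Set.mem_insert _ _
        · exact (hxy h).elim
      have h1 := Set.ncard_le_ncard this (Set.toFinite _)
      have h2 := Set.ncard_insert_le y ((G \ B).neighborSet z)
      have h3 := hx.2
      omega
    by_cases hzy : z = y
    · subst hzy
      have : ((G ⊔ SimpleGraph.edge x z) \ B).neighborSet z ⊆
          insert x ((G \ B).neighborSet z) := by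
        intro v hv
        rcases hsub hv with h | ⟨h, -⟩ | ⟨-, rfl⟩
        · exact Set.mem_insert_of_mem _ h
        · exact (hzx h).elim
        · exact Set.mem_insert _ _
      have h1 := Set.ncard_le_ncard this (Set.toFinite _)
      have h2 := Set.ncard_insert_le x ((G \ B).neighborSet z)
      have h3 := hy.2
      omega
    · refine (Set.ncard_le_ncard ?_ (Set.toFinite _)).trans (hd z)
      intro v hv
      rcases hsub hv with h | ⟨h, -⟩ | ⟨h, -⟩
      · exact h
      · exact (hzx h).elim
      · exact (hzy h).elim
  · intro v c hc
    by_contra! hcg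
    exact hno (SimpleGraph.exists_walk_of_isCycle_sup_edge hgG c hc hcg)

/-- Handshake: each vertex of `S` that is not deficient contributes at least `d` to the degree sum.
-/
lemma SimpleGraph.mul_ncard_le_two_mul_card_edgeSet [Finite V] (G : SimpleGraph V) (S : Set V)
    (d : ℕ) : d * S.ncard ≤
      2 * Nat.card G.edgeSet + d * {x ∈ S | (G.neighborSet x).ncard < d}.ncard := by
  classical
  have := Fintype.ofFinite V
  have hdeg : ∀ x, (G.neighborSet x).ncard = G.degree x := fun x => by
    rw [Set.ncard_eq_toFinset_card', ← SimpleGraph.card_neighborFinset_eq_degree]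
    rfl
  have h1 : S.ncard = {x ∈ S | (G.neighborSet x).ncard < d}.ncard
      + {x ∈ S | d ≤ (G.neighborSet x).ncard}.ncard := by
    rw [← Set.ncard_union_eq _ (Set.toFinite _) (Set.toFinite _)]
    · congr 1
      ext x
      simp only [Set.mem_union, Set.mem_ofPred_eq]
      have := lt_or_ge (G.neighborSet x).ncard d
      tauto
    · exact Set.disjoint_left.2 fun x hx hx' => hx.2.not_ge hx'.2
  have h2 : d * {x ∈ S | d ≤ (G.neighborSet x).ncard}.ncard ≤ 2 * Nat.card G.edgeSet := by
    rw [Nat.card_eq_fintype_card, ← SimpleGraph.edgeFinset_card,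
      ← G.sum_degrees_eq_twice_card_edges, Set.ncard_eq_toFinset_card', mul_comm, ← smul_eq_mul]
    refine (Finset.card_nsmul_le_sum _ (fun x => G.degree x) d fun x hx => ?_).trans
      (Finset.sum_le_sum_of_subset (f := fun x => G.degree x) (Finset.subset_univ _))
    have hx' : x ∈ S ∧ d ≤ (G.neighborSet x).ncard := by simpa using hx
    exact hdeg x ▸ hx'.2
  rw [h1, mul_add]
  omega

/-- A connected graph without short cycles, obtained by adding many edges to a tree. -/
lemma SimpleGraph.IsTree.exists_connected_of_lt_girth [Finite V] {B : SimpleGraph V}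
    (hB : B.IsTree) (S : Set V) {d g M : ℕ} (hg1 : 1 ≤ g)
    (hball : ∀ G : SimpleGraph V, B ≤ G → (∀ x y, (G \ B).Adj x y → x ∈ S) →
      (∀ x, ((G \ B).neighborSet x).ncard ≤ d) →
      ∀ x ∈ S, {y ∈ S | ∃ p : G.Walk x y, p.length ≤ g}.ncard ≤ M) :
    ∃ G : SimpleGraph V, G.Connected ∧ (∀ v (c : G.Walk v v), c.IsCycle → g < c.length) ∧
      d * S.ncard + 2 * Nat.card V ≤ 2 * Nat.card G.edgeSet + 2 + d * M := by
  obtain ⟨G, hBG, hgG, hM⟩ := SimpleGraph.exists_extension_of_lt_girth B S hg1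
    (fun v c hc => (hB.isAcyclic c hc).elim) hball
  refine ⟨G, hB.connected.mono hBG, hgG, ?_⟩
  have h1 := (G \ B).mul_ncard_le_two_mul_card_edgeSet S d
  have h2 := Nat.mul_le_mul_left d hM
  have h3 := (SimpleGraph.isTree_iff_connected_and_card.1 hB).2
  have h4 : Nat.card G.edgeSet = Nat.card B.edgeSet + Nat.card (G \ B).edgeSet := by
    have hu : G.edgeSet = B.edgeSet ∪ (G \ B).edgeSet := by
      rw [← SimpleGraph.edgeSet_sup, sup_sdiff_cancel_right hBG]
    rw [Nat.card_coe_set_eq, Nat.card_coe_set_eq, Nat.card_coe_set_eq, hu,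
      Set.ncard_union_eq _ (Set.toFinite _) (Set.toFinite _)]
    rw [SimpleGraph.edgeSet_sdiff]
    exact Set.disjoint_sdiff_right
  omega

end Greedy

/-! ### Growth of balls -/

section Balls

lemma SimpleGraph.ncard_setOf_walk_length_le {V : Type v} [Finite V] {G : SimpleGraph V} {D : ℕ}
    (hD : ∀ x, (G.neighborSet x).ncard ≤ D) (x : V) (g : ℕ) :
    {y | ∃ p : G.Walk x y, p.length ≤ g}.ncard ≤ (D + 1) ^ g := by
  classical
  have := Fintype.ofFinite V
  induction g with
  | zero =>
    have : {y | ∃ p : G.Walk x y, p.length ≤ 0} ⊆ {x} := by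
      rintro y ⟨p, hp⟩
      exact (SimpleGraph.Walk.eq_of_length_eq_zero (Nat.le_zero.1 hp)).symm
    exact (Set.ncard_le_ncard this).trans (by simp)
  | succ g ih =>
    rw [Set.ncard_eq_toFinset_card'] at ih
    have hsub : {y | ∃ p : G.Walk x y, p.length ≤ g + 1} ⊆
        (({y | ∃ p : G.Walk x y, p.length ≤ g}.toFinset.biUnion
          fun z => insert z (G.neighborSet z).toFinset : Finset V) : Set V) := by
      rintro y ⟨p, hp⟩
      simp only [Finset.coe_biUnion, Set.mem_iUnion, Finset.mem_coe, Finset.mem_insert,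
        Set.mem_toFinset, Set.mem_ofPred_eq, exists_prop]
      cases p using SimpleGraph.Walk.concatRec with
      | Hnil => exact ⟨_, ⟨.nil, by simp⟩, .inl rfl⟩
      | Hconcat q h =>
        rw [SimpleGraph.Walk.length_concat] at hp
        exact ⟨_, ⟨q, by omega⟩, .inr h⟩
    refine (Set.ncard_le_ncard hsub (Finset.finite_toSet _)).trans ?_
    rw [Set.ncard_coe_finset, pow_succ]
    refine (Finset.card_biUnion_le_card_mul _ _ (D + 1) fun z _ => ?_).trans
      (Nat.mul_le_mul_right _ ih)
    refine (Finset.card_insert_le _ _).trans (Nat.add_le_add_right ?_ 1)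
    rw [← Set.ncard_eq_toFinset_card']
    exact hD z

lemma SimpleGraph.ncard_neighborSet_pathGraph_le {n : ℕ} (x : Fin n) :
    ((SimpleGraph.pathGraph n).neighborSet x).ncard ≤ 2 := by
  have h := Set.ncard_le_ncard_of_injOn (s := (SimpleGraph.pathGraph n).neighborSet x)
    (t := {x.val + 1, x.val - 1}) Fin.val ?_ Fin.val_injective.injOn
  · exact h.trans ((Set.ncard_insert_le _ _).trans (by simp))
  · intro y hy
    have := SimpleGraph.pathGraph_adj.1 hy
    simp only [Set.mem_insert_iff, Set.mem_singleton_iff]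
    omega

/-- The sets of integers reached by unit steps and free applications of an involution. -/
lemma exists_growing_sets {μ : ℕ → ℕ} (hμ : Function.Involutive μ) (s : ℕ) :
    ∃ E : ℕ → Finset ℕ, s ∈ E 0 ∧ Monotone E ∧ (∀ k, ∀ j ∈ E k, μ j ∈ E k) ∧
      (∀ k, ∀ j ∈ E k, j + 1 ∈ E (k + 1) ∧ j - 1 ∈ E (k + 1)) ∧
      ∀ k, (E k).card ≤ 2 * 6 ^ k := by
  classical
  let cl : Finset ℕ → Finset ℕ := fun A => A ∪ A.image μ
  let D : Finset ℕ → Finset ℕ := fun A => A ∪ (A.image (· + 1) ∪ A.image (· - 1))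
  have hcl : ∀ A, A ⊆ cl A := fun A => Finset.subset_union_left
  have hclμ : ∀ A, ∀ j ∈ cl A, μ j ∈ cl A := by
    intro A j hj
    rcases Finset.mem_union.1 hj with h | h
    · exact Finset.mem_union_right _ (Finset.mem_image_of_mem _ h)
    · obtain ⟨i, hi, rfl⟩ := Finset.mem_image.1 h
      rw [hμ i]
      exact Finset.mem_union_left _ hi
  have hclc : ∀ A, (cl A).card ≤ 2 * A.card := fun A => by
    have h1 := Finset.card_union_le A (A.image μ)
    have h2 := Finset.card_image_le (s := A) (f := μ)
    simp only [cl]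
    omega
  have hDc : ∀ A, (D A).card ≤ 3 * A.card := fun A => by
    have h1 := Finset.card_union_le A (A.image (· + 1) ∪ A.image (· - 1))
    have h2 := Finset.card_union_le (A.image (· + 1)) (A.image (· - 1))
    have h3 := Finset.card_image_le (s := A) (f := (· + 1))
    have h4 := Finset.card_image_le (s := A) (f := (· - 1))
    simp only [D]
    omega
  -- Staying or moving up or down costs a factor 3 and closing under `μ` a factor 2, hence the 6.
  -- Truncation at 0 only adds a step that stays put.
  let E : ℕ → Finset ℕ := fun k => Nat.rec (cl {s}) (fun _ A => cl (D A)) k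
  have hE : ∀ k, E (k + 1) = cl (D (E k)) := fun k => rfl
  refine ⟨E, hcl _ (Finset.mem_singleton_self s), monotone_nat_of_le_succ fun k => ?_, ?_, ?_, ?_⟩
  · rw [hE]
    exact (Finset.subset_union_left).trans (hcl _)
  · rintro (_ | k)
    · exact hclμ _
    · exact hclμ _
  · intro k j hj
    rw [hE]
    exact ⟨hcl _ (Finset.mem_union_right _ (Finset.mem_union_left _
        (Finset.mem_image_of_mem (· + 1) hj))),
      hcl _ (Finset.mem_union_right _ (Finset.mem_union_right _
        (Finset.mem_image_of_mem (· - 1) hj)))⟩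
  · intro k
    induction k with
    | zero => exact hclc {s}
    | succ k ih =>
      rw [hE]
      have h1 := hclc (D (E k))
      have h2 := hDc (E k)
      rw [pow_succ]
      omega

/-- In a path together with a matching between vertices spaced `L` apart, few of these vertices
are near any one of them. -/
lemma SimpleGraph.ncard_near_multiples_le {n L : ℕ} (hL : 1 ≤ L) {G B : SimpleGraph (Fin n)}
    (hB : B ≤ SimpleGraph.pathGraph n) (hS : ∀ x y, (G \ B).Adj x y → L ∣ x.val)
    (hd : ∀ x, ((G \ B).neighborSet x).ncard ≤ 1) (g : ℕ) (x : Fin n) (hx : L ∣ x.val) :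
    {y ∈ {y : Fin n | L ∣ y.val} | ∃ p : G.Walk x y, p.length ≤ g}.ncard ≤ 2 * 6 ^ (g / L) := by
  classical
  have huniq : ∀ u v v', (G \ B).Adj u v → (G \ B).Adj u v' → v = v' := fun u v v' h h' =>
    (Set.ncard_le_one_iff (Set.toFinite _)).1 (hd u) h h'
  -- `μ` is the matching read on the indices of the multiples of `L`, fixing the unmatched ones.
  let μ : ℕ → ℕ := fun j =>
    if h : ∃ v : Fin n, ∃ u, (G \ B).Adj u v ∧ u.val / L = j then h.choose.val / L else j
  have hμ : ∀ u v, (G \ B).Adj u v → μ (u.val / L) = v.val / L := by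
    intro u v huv
    have h : ∃ v : Fin n, ∃ u', (G \ B).Adj u' v ∧ u'.val / L = u.val / L := ⟨v, u, huv, rfl⟩
    simp only [μ, dif_pos h]
    obtain ⟨u', hu', he⟩ := h.choose_spec
    have hu : u' = u := by
      refine Fin.ext ?_
      rw [← Nat.div_mul_cancel (hS _ _ hu'), he, Nat.div_mul_cancel (hS _ _ huv)]
    rw [hu] at hu'
    rw [huniq u _ _ hu' huv]
  have hinv : Function.Involutive μ := by
    intro j
    by_cases h : ∃ v : Fin n, ∃ u, (G \ B).Adj u v ∧ u.val / L = j
    · obtain ⟨v, u, huv, rfl⟩ := h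
      rw [hμ u v huv, hμ v u huv.symm]
    · have : μ j = j := by simp only [μ, dif_neg h]
      rw [this, this]
  obtain ⟨E, hE0, hEmono, hEμ, hEstep, hEcard⟩ := exists_growing_sets hinv (x.val / L)
  have hup : ∀ i k j, j ∈ E k → j + i ∈ E (k + i) ∧ j - i ∈ E (k + i) := by
    intro i
    induction i with
    | zero => intro k j hj; exact ⟨hj, hj⟩
    | succ i ih =>
      intro k j hj
      exact ⟨(hEstep _ _ (ih k j hj).1).1, (hEstep _ _ (ih k j hj).2).2⟩
  have hmove : ∀ k j i, j ∈ E k → i ∈ E (k + ((i - j) + (j - i))) := by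
    intro k j i hj
    rcases le_total i j with h | h
    · have := (hup (j - i) k j hj).2
      rw [Nat.sub_sub_self h] at this
      rwa [Nat.sub_eq_zero_of_le h, zero_add]
    · have := (hup (i - j) k j hj).1
      rw [Nat.add_sub_cancel' h] at this
      rwa [Nat.sub_eq_zero_of_le h, add_zero]
  have hreach : ∀ (k h i r : ℕ), h ∈ E k →
      k * L + ((i * L - h * L) + (h * L - i * L)) ≤ r → ∃ k', i ∈ E k' ∧ k' * L ≤ r := by
    intro k h i r hh hr
    refine ⟨_, hmove k h i hh, ?_⟩
    rwa [add_mul, add_mul, Nat.sub_mul, Nat.sub_mul]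
  -- Invariant: `h` is the anchor last used, `k` counts the full stretches of length `L` paid for,
  -- and the two truncated differences add up to the distance from the anchor. A matching edge
  -- starts at a multiple of `L`, where the anchor is moved before jumping for free.
  have hwalk : ∀ y (p : G.Walk x y), ∃ k, ∃ h ∈ E k,
      k * L + ((y.val - h * L) + (h * L - y.val)) ≤ p.length := by
    intro y p
    generalize hz : x = z at p
    induction p using SimpleGraph.Walk.concatRec with
    | Hnil =>
      subst hz
      exact ⟨0, x.val / L, hE0, by simp [Nat.div_mul_cancel hx]⟩
    | @Hconcat z u v q huv ih =>
      obtain ⟨k, h, hh, hle⟩ := ih hz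
      rw [SimpleGraph.Walk.length_concat]
      by_cases hBuv : B.Adj u v
      · have := SimpleGraph.pathGraph_adj.1 (hB hBuv)
        exact ⟨k, h, hh, by omega⟩
      · have hGB : (G \ B).Adj u v := ⟨huv, hBuv⟩
        have hu := Nat.div_mul_cancel (hS _ _ hGB)
        have hv := Nat.div_mul_cancel (hS _ _ hGB.symm)
        obtain ⟨k', hk', hle'⟩ := hreach k h (u.val / L) q.length hh (by rwa [hu])
        have := hEμ k' _ hk'
        rw [hμ u v hGB] at this
        exact ⟨k', _, this, by rw [hv]; omega⟩
  have := Set.ncard_le_ncard_of_injOn (t := (E (g / L) : Set ℕ))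
    (s := {y ∈ {y : Fin n | L ∣ y.val} | ∃ p : G.Walk x y, p.length ≤ g})
    (fun y => y.val / L) ?_ ?_ (Finset.finite_toSet _)
  · rw [Set.ncard_coe_finset] at this
    exact this.trans (hEcard _)
  · rintro y ⟨hy, p, hp⟩
    obtain ⟨k, h, hh, hle⟩ := hwalk y p
    obtain ⟨k', hk', hle'⟩ := hreach k h (y.val / L) g hh (by
      rw [Nat.div_mul_cancel hy]; omega)
    exact hEmono ((Nat.le_div_iff_mul_le hL).2 hle') hk'
  · rintro y ⟨hy, -⟩ y' ⟨hy', -⟩ hyy'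
    refine Fin.ext ?_
    rw [← Nat.div_mul_cancel hy, ← Nat.div_mul_cancel hy']
    exact congrArg (· * L) hyy'

end Balls

/-! ### Graphs of large girth with many edges -/

section Graphs

/-- Division with remainder: a number is determined by the multiple below it and its residue. -/
lemma Fin.le_ncard_multiples_mul {n L : ℕ} (hL : 1 ≤ L) :
    n ≤ {y : Fin n | L ∣ y.val}.ncard * L := by
  classical
  have h := Fintype.card_le_of_injective
    (fun y : Fin n => ((⟨⟨y.val / L * L, (Nat.div_mul_le_self _ _).trans_lt y.2⟩,
      Dvd.intro_left _ rfl⟩, ⟨y.val % L, Nat.mod_lt _ hL⟩) :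
        {y : Fin n | L ∣ y.val} × Fin L)) (by
    intro y y' h
    simp only [Prod.mk.injEq, Subtype.mk.injEq, Fin.mk.injEq] at h
    refine Fin.ext ?_
    rw [← Nat.div_add_mod' y.val L, ← Nat.div_add_mod' y'.val L, h.1, h.2])
  rwa [Fintype.card_fin, Fintype.card_prod, Fintype.card_fin, ← Nat.card_eq_fintype_card,
    Nat.card_coe_set_eq] at h

lemma SimpleGraph.exists_isTree_le_pathGraph {n : ℕ} (hn : 1 ≤ n) :
    ∃ B ≤ SimpleGraph.pathGraph n, B.IsTree := by
  obtain ⟨m, rfl⟩ := Nat.exists_eq_add_of_le' hn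
  exact (SimpleGraph.pathGraph_connected m).exists_isTree_le

/-- Connected graphs with `n` vertices, girth at least `k` and of order `n ^ (1 + 1 / k)` edges. -/
lemma SimpleGraph.exists_pow_le_card_edgeSet {k n : ℕ} (hk : 1 ≤ k) (hn : 1 ≤ n) :
    ∃ G : SimpleGraph (Fin n), G.Connected ∧ (∀ v (c : G.Walk v v), c.IsCycle → k ≤ c.length) ∧
      1 / 8 * (n : ℝ) ^ (1 + 1 / (k : ℝ)) ≤ max (n : ℝ) (Nat.card G.edgeSet) := by
  have : NeZero n := ⟨by omega⟩
  have hn0 : (1 : ℝ) ≤ n := by exact_mod_cast hn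
  have hk0 : (1 : ℝ) ≤ k := by exact_mod_cast hk
  obtain ⟨B, hBp, hB⟩ := SimpleGraph.exists_isTree_le_pathGraph hn
  rw [Real.rpow_add (by linarith), Real.rpow_one]
  set a : ℝ := (n : ℝ) ^ (1 / (k : ℝ)) with ha
  have hak : a ^ k = n := by
    rw [ha, ← Real.rpow_natCast, ← Real.rpow_mul (by linarith), one_div_mul_cancel (by linarith),
      Real.rpow_one]
  -- For `a ≤ 8` the bound is at most `n`; this is why the statement has a maximum.
  rcases le_or_gt a 8 with ha8 | ha8
  · refine ⟨B, hB.connected, fun v c hc => (hB.isAcyclic c hc).elim, le_max_of_le_left ?_⟩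
    nlinarith
  rcases hk.eq_or_lt with rfl | hk2
  · refine ⟨⊤, SimpleGraph.connected_top, fun v c hc => by have := hc.three_le_length; omega,
      le_max_of_le_right ?_⟩
    classical
    rw [pow_one] at hak
    have h1 : Nat.card (⊤ : SimpleGraph (Fin n)).edgeSet = n.choose 2 := by
      rw [Nat.card_eq_fintype_card, ← SimpleGraph.edgeFinset_card,
        SimpleGraph.card_edgeFinset_top_eq_card_choose_two, Fintype.card_fin]
    rw [h1, Nat.cast_choose_two, hak]
    rw [hak] at ha8
    nlinarith
  · have hfl := Nat.lt_floor_add_one a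
    have hfl' := Nat.floor_le (show 0 ≤ a by linarith)
    have h8 : 8 ≤ ⌊a⌋₊ := Nat.le_floor (by exact_mod_cast ha8.le)
    -- The 3 is the path's degree 2 plus 1 for staying put, so balls of radius `k - 1` have at most
    -- `a ^ (k - 1) ≤ n / 8` points.
    obtain ⟨d, hd⟩ := Nat.exists_eq_add_of_le' (show 3 ≤ ⌊a⌋₊ by omega)
    rw [hd] at hfl hfl'
    push_cast at hfl hfl'
    obtain ⟨G, hG, hgG, hE⟩ := hB.exists_connected_of_lt_girth Set.univ (d := d) (g := k - 1)
      (M := (d + 2 + 1) ^ (k - 1)) (by omega) <| by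
        intro G hBG _ hGd x _
        simp only [Set.mem_univ, true_and]
        refine SimpleGraph.ncard_setOf_walk_length_le (fun y => ?_) x _
        have hsub : G.neighborSet y ⊆
            (G \ B).neighborSet y ∪ (SimpleGraph.pathGraph n).neighborSet y := by
          intro z hz
          by_cases h : B.Adj y z
          · exact .inr (hBp h)
          · exact .inl ⟨hz, h⟩
        have h1 := Set.ncard_le_ncard hsub (Set.toFinite _)
        have h2 := Set.ncard_union_le ((G \ B).neighborSet y)
          ((SimpleGraph.pathGraph n).neighborSet y)
        have h3 := hGd y
        have h4 := SimpleGraph.ncard_neighborSet_pathGraph_le y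
        omega
    refine ⟨G, hG, fun v c hc => by have := hgG v c hc; omega, le_max_of_le_right ?_⟩
    rw [Set.ncard_univ, Nat.card_eq_fintype_card, Fintype.card_fin] at hE
    have hM : ((d + 2 + 1 : ℝ)) ^ (k - 1) * 8 ≤ n := by
      calc ((d + 2 + 1 : ℝ)) ^ (k - 1) * 8 ≤ a ^ (k - 1) * a := by
            gcongr
            linarith
        _ = n := by rw [← pow_succ, Nat.sub_add_cancel hk, hak]
    have hE' : (d : ℝ) * n + 2 * n ≤ 2 * Nat.card G.edgeSet + 2 + d * (d + 2 + 1) ^ (k - 1) := by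
      exact_mod_cast hE
    have hd0 : a / 2 ≤ d := by linarith
    have h1 := mul_le_mul_of_nonneg_left hM (show (0 : ℝ) ≤ d by positivity)
    have h2 := mul_le_mul_of_nonneg_right hd0 (show (0 : ℝ) ≤ n by positivity)
    nlinarith

/-- Connected graphs with `n` vertices, `(1 + ε) n` edges and girth of order `log n / ε`. -/
lemma SimpleGraph.exists_one_add_mul_le_card_edgeSet {ε : ℝ} (hε : 0 < ε) (hε1 : ε < 1) :
    ∃ N : ℕ, 2 ≤ N ∧ ∀ n : ℕ, N ≤ n → ∃ G : SimpleGraph (Fin n), G.Connected ∧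
      (∀ v (c : G.Walk v v), c.IsCycle → Real.logb 2 n / (192 * ε) ≤ c.length) ∧
      (1 + ε) * n ≤ Nat.card G.edgeSet := by
  have hlog : ∀ (j b n : ℕ), 1 ≤ j → b = 2 ^ j → 1 ≤ n →
      Real.logb 2 n ≤ j * (Nat.log b n + 1) := by
    intro j b n hj hb hn
    have hb1 : 1 < b := hb ▸ Nat.one_lt_two_pow (by omega)
    have h := Nat.lt_pow_succ_log_self hb1 n
    rw [hb, ← pow_mul, ← hb] at h
    have h' : (n : ℝ) ≤ 2 ^ (j * (Nat.log b n + 1)) := by exact_mod_cast h.le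
    rw [Real.logb_le_iff_le_rpow (by norm_num) (by exact_mod_cast hn)]
    exact_mod_cast h'
  rcases le_or_gt ε (1 / 8) with hε8 | hε8
  · refine ⟨⌈1 / ε ^ 2⌉₊ + 64, by omega, fun n hn => ?_⟩
    have hnε : 1 ≤ n * ε ^ 2 := by
      have h1 := Nat.le_ceil (1 / ε ^ 2)
      have h2 : ((⌈1 / ε ^ 2⌉₊ + 64 : ℕ) : ℝ) ≤ n := by exact_mod_cast hn
      push_cast at h2
      rw [← div_le_iff₀ (by positivity)]
      linarith
    have hn1 : 1 ≤ n := by omega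
    obtain ⟨B, hBp, hB⟩ := SimpleGraph.exists_isTree_le_pathGraph hn1
    have h8ε : 1 ≤ 1 / (8 * ε) := by
      rw [le_div_iff₀ (by positivity)]
      linarith
    -- This spacing leaves at least `8 * ε * n` vertices to match, so about `4 * ε * n` new edges
    -- before losses.
    obtain ⟨L, hLdef⟩ : ∃ L, L = ⌊1 / (8 * ε)⌋₊ := ⟨_, rfl⟩
    have hL : 1 ≤ L := hLdef ▸ Nat.le_floor (by exact_mod_cast h8ε)
    have hL' : (1 : ℝ) ≤ L := by exact_mod_cast hL
    have hLle : L * (8 * ε) ≤ 1 := by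
      rw [← le_div_iff₀ (by positivity), hLdef]
      exact Nat.floor_le (by positivity)
    have hLge : 1 / (16 * ε) ≤ L := by
      have h := Nat.lt_floor_add_one (1 / (8 * ε))
      rw [← hLdef] at h
      have h2 : 1 / (16 * ε) = 1 / (8 * ε) / 2 := by field_simp; norm_num
      linarith
    -- As `36 ≤ 64`, the loss `6 ^ q` is at most `√n`.
    obtain ⟨q, hqdef⟩ : ∃ q, q = Nat.log 64 n := ⟨_, rfl⟩
    have hq : 1 ≤ q := hqdef ▸ Nat.log_pos (by norm_num) (by omega)
    have hqn : 64 ^ q ≤ n := hqdef ▸ Nat.pow_log_le_self 64 (by omega)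
    obtain ⟨G, hG, hgG, hE⟩ := hB.exists_connected_of_lt_girth {y : Fin n | L ∣ y.val} (d := 1)
      (g := L * q) (M := 2 * 6 ^ q) (Nat.mul_pos hL hq) <| by
        intro G _ hS hGd x hx
        have := SimpleGraph.ncard_near_multiples_le hL hBp hS hGd (L * q) x hx
        rwa [Nat.mul_div_cancel_left q hL] at this
    refine ⟨G, hG, fun v c hc => ?_, ?_⟩
    · have h1 := hlog 6 64 n (by norm_num) (by norm_num) hn1
      rw [← hqdef] at h1
      have h2 : ((L * q : ℕ) : ℝ) ≤ c.length := by exact_mod_cast (hgG v c hc).le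
      push_cast at h1 h2
      refine le_trans ?_ h2
      have hq' : (1 : ℝ) ≤ q := by exact_mod_cast hq
      calc Real.logb 2 n / (192 * ε) ≤ 12 * q / (192 * ε) := by gcongr; linarith
        _ = 1 / (16 * ε) * q := by field_simp; norm_num
        _ ≤ L * q := by gcongr
    · have h1 := Fin.le_ncard_multiples_mul (n := n) hL
      rw [Nat.card_eq_fintype_card, Fintype.card_fin, one_mul, one_mul] at hE
      set S := {y : Fin n | L ∣ y.val}.ncard
      have h1' : (n : ℝ) ≤ S * L := by exact_mod_cast h1
      have hE' : (S : ℝ) + 2 * n ≤ 2 * Nat.card G.edgeSet + 2 + 2 * 6 ^ q := by exact_mod_cast hE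
      have h2 : 8 * ε * n ≤ S := by
        have h3 := mul_le_mul_of_nonneg_left h1' (show 0 ≤ 8 * ε by positivity)
        have h4 := mul_le_mul_of_nonneg_left hLle (show (0 : ℝ) ≤ S by positivity)
        linarith
      have hs1 : (1 : ℝ) ≤ 6 ^ q := one_le_pow₀ (by norm_num)
      have hs2 : ((6 : ℝ) ^ q) ^ 2 ≤ n := by
        have h3 : (6 ^ q) ^ 2 ≤ n := by
          rw [← pow_mul, mul_comm, pow_mul]
          exact (Nat.pow_le_pow_left (by norm_num) q).trans hqn
        exact_mod_cast h3
      have hs3 : (6 : ℝ) ^ q ≤ ε * n := by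
        refine (sq_le_sq₀ (by positivity) (by positivity)).1 ?_
        nlinarith
      linarith
  -- Here `ε` is bounded below, so girth of order `log n` suffices; `n ^ (1 / k) ≥ 1024` yields at
  -- least `128 * n` edges.
  · refine ⟨1024, by norm_num, fun n hn => ?_⟩
    have hn1 : 1 ≤ n := by omega
    have hn1' : (1 : ℝ) ≤ n := by exact_mod_cast hn1
    obtain ⟨k, hkdef⟩ : ∃ k, k = Nat.log 1024 n := ⟨_, rfl⟩
    have hk : 1 ≤ k := hkdef ▸ Nat.log_pos (by norm_num) hn
    have hk' : (1 : ℝ) ≤ k := by exact_mod_cast hk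
    have hkn : 1024 ^ k ≤ n := hkdef ▸ Nat.pow_log_le_self 1024 (by omega)
    obtain ⟨G, hG, hgG, hE⟩ := SimpleGraph.exists_pow_le_card_edgeSet hk hn1
    refine ⟨G, hG, fun v c hc => ?_, ?_⟩
    · have h1 := hlog 10 1024 n (by norm_num) (by norm_num) hn1
      rw [← hkdef] at h1
      have h2 : (k : ℝ) ≤ c.length := by exact_mod_cast hgG v c hc
      push_cast at h1
      rw [div_le_iff₀ (by positivity)]
      nlinarith
    · have h1 : (1024 : ℝ) ≤ (n : ℝ) ^ (1 / (k : ℝ)) := by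
        have h2 : ((1024 : ℝ) ^ k) ≤ n := by exact_mod_cast hkn
        calc (1024 : ℝ) = ((1024 : ℝ) ^ k) ^ (1 / (k : ℝ)) := by
              rw [← Real.rpow_natCast, ← Real.rpow_mul (by norm_num),
                mul_one_div_cancel (by linarith), Real.rpow_one]
          _ ≤ _ := by gcongr
      rw [Real.rpow_add (by linarith), Real.rpow_one] at hE
      rcases le_max_iff.1 hE with h | h
      · nlinarith
      · nlinarith

end Graphs

/-! ### Assembling the two bounds -/

lemma card_le_totalCopies {X : Type v} [Fintype X] {Y : Type u} {f : X → Set Y}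
    (hf : ∀ x, (f x).Nonempty) : (Fintype.card X : ℝ≥0∞) ≤ totalCopies f := by
  have h : ∀ x ∈ Finset.univ, (1 : ℝ≥0∞) ≤ ((f x).encard : ℝ≥0∞) := fun x _ => by
    exact_mod_cast Set.one_le_encard_iff_nonempty.2 (hf x)
  simpa [totalCopies] using Finset.sum_le_sum h

theorem theorem2 :
    (∃ c : ℝ, 0 < c ∧
      ∀ ε : ℝ, 0 < ε → ε < 1 → ∃ N : ℕ, ∀ n : ℕ, N ≤ n →
        ∃ (X : Type) (_ : Fintype X) (_ : MetricSpace X), Fintype.card X = n ∧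
          ∀ (V : Type u) (T : SimpleGraph V) (w : Sym2 V → ℝ≥0), T.IsTree →
            ∀ (f : X → Set V) (χ : X → V) (t : ℝ), t ≤ c * (Real.logb 2 n / ε) →
              IsClanEmbedding (weightedDist T w) f χ →
              HasClanDistortion (weightedDist T w) f χ t →
                ENNReal.ofReal ((1 + ε) * n) ≤ totalCopies f) ∧
    (∃ c : ℝ, 0 < c ∧ ∃ c' : ℝ, 0 < c' ∧
      ∀ k : ℕ, 1 ≤ k → ∀ n : ℕ,
        ∃ (X : Type) (_ : Fintype X) (_ : MetricSpace X), Fintype.card X = n ∧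
          ∀ (V : Type u) (T : SimpleGraph V) (w : Sym2 V → ℝ≥0), T.IsTree →
            ∀ (f : X → Set V) (χ : X → V) (t : ℝ), t ≤ c * k →
              IsClanEmbedding (weightedDist T w) f χ →
              HasClanDistortion (weightedDist T w) f χ t →
                ENNReal.ofReal (c' * (n : ℝ) ^ (1 + 1 / (k : ℝ))) ≤ totalCopies f) := by
  constructor
  -- Any constant below `1 / (16 * 192)` works.
  · refine ⟨1 / 4000, by norm_num, fun ε hε hε1 => ?_⟩
    obtain ⟨N, hN, h⟩ := SimpleGraph.exists_one_add_mul_le_card_edgeSet hε hε1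
    refine ⟨N, fun n hn => ?_⟩
    obtain ⟨G, hG, hgG, hE⟩ := h n hn
    refine ⟨Fin n, inferInstance, hG.metricSpace, Fintype.card_fin n,
      fun V T w hT f χ t ht hf hd => ?_⟩
    refine le_trans ?_ (card_edgeSet_le_totalCopies hG (fun v c hc => ?_) w hT f χ hf hd)
    · exact ENNReal.ofReal_le_of_le_toReal (by simpa using hE)
    · have hlog : 0 < Real.logb 2 n :=
        Real.logb_pos (by norm_num) (by exact_mod_cast (show 1 < n by omega))
      have h1 := hgG v c hc
      have h2 : Real.logb 2 n / (192 * ε) = 1 / 192 * (Real.logb 2 n / ε) := by field_simp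
      have h3 : 0 < Real.logb 2 n / ε := by positivity
      linarith
  · refine ⟨1 / 32, by norm_num, 1 / 8, by norm_num, fun k hk n => ?_⟩
    have hk0 : (1 : ℝ) ≤ k := by exact_mod_cast hk
    rcases Nat.eq_zero_or_pos n with rfl | hn
    · refine ⟨Empty, inferInstance, inferInstance, by simp, fun V T w hT f χ t ht hf hd => ?_⟩
      rw [Nat.cast_zero, Real.zero_rpow (by positivity)]
      simp
    obtain ⟨G, hG, hgG, hE⟩ := SimpleGraph.exists_pow_le_card_edgeSet hk hn
    refine ⟨Fin n, inferInstance, hG.metricSpace, Fintype.card_fin n,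
      fun V T w hT f χ t ht hf hd => ?_⟩
    -- When the maximum is `n`, one copy per point is already enough.
    rcases le_max_iff.1 hE with h | h
    · let := hG.metricSpace
      refine le_trans ?_ (card_le_totalCopies hf.nonempty)
      exact ENNReal.ofReal_le_of_le_toReal (by simpa using h)
    · refine le_trans ?_ (card_edgeSet_le_totalCopies hG (fun v c hc => ?_) w hT f χ hf hd)
      · exact ENNReal.ofReal_le_of_le_toReal (by simpa using h)
      · have : (k : ℝ) ≤ c.length := by exact_mod_cast hgG v c hc
        linarith
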